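/- Let $\mathrm{H}(\mathbb{R})$ be the group (under composition) of all homeomorphisms of the real line. Let $\mathrm{PL}(\mathbb{R})$ be its subgroup of homeomorphisms that are locally affine at all but a discrete set of points of $\mathbb{R}$, and let $\mathrm{PLF}(\mathbb{R})$ be its subgroup of homeomorphisms that are locally affine at all but finitely many points of $\mathbb{R}$. An element $h$ of a group $G$ reverses $g\in G$ if $hgh^{-1}=g^{-1}$. An element $g\in G$ is reversible in $G$ if some element of $G$ reverses it, and strongly reversible in $G$ if some $\sigma\in G$ with $\sigma^2=1$ reverses it. A homeomorphism of $\mathbb{R}$ is orientation preserving (reversing) if it is strictly increasing (decreasing). Then: (i) In $\mathrm{H}(\mathbb{R})$, an orientation preserving reversible map $f$ is strongly reversible if and only if it is reversed by an orientation reversing element of $\mathrm{H}(\mathbb{R})$. (ii) An element of $\mathrm{PLF}(\mathbb{R})$ is reversible in $\mathrm{PLF}(\mathbb{R})$ if and only if it is strongly reversible in $\mathrm{PLF}(\mathbb{R})$. (iii) An orientation preserving element $f$ of $\mathrm{PL}(\mathbb{R})$ that is reversible in $\mathrm{PL}(\mathbb{R})$ is strongly reversible in $\mathrm{PL}(\mathbb{R})$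 if and only if it is reversed by an orientation reversing element of $\mathrm{PL}(\mathbb{R})$. -/

import Mathlib

namespace Reversibility

section Group

variable {G : Type*} [Group G]

/-- `h` reverses `g`: conjugation by `h` turns `g` into its inverse. -/
def Reverses (h g : G) : Prop := h * g * h⁻¹ = g⁻¹

/-- `g` is reversible in `G`. -/
def IsReversible (g : G) : Prop := ∃ h : G, Reverses h g

/-- `g` is strongly reversible in `G`: it is reversed by an involution, an involution being an
element whose square is the identity. -/
def IsStronglyReversible (g : G) : Prop := ∃ σ : G, σ ^ 2 = 1 ∧ Reverses σ g

end Group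

/-- `f` is affine on a neighbourhood of `x`. -/
def LocallyAffineAt (f : ℝ → ℝ) (x : ℝ) : Prop :=
  ∃ a b : ℝ, ∀ᶠ y in nhds x, f y = a * y + b

/-- The set of points at which `f` is not locally affine. -/
def breakSet (f : ℝ → ℝ) : Set ℝ := {x | ¬ LocallyAffineAt f x}

theorem isClosed_breakSet (f : ℝ → ℝ) : IsClosed (breakSet f) := by
  rw [← isOpen_compl_iff, isOpen_iff_mem_nhds]
  intro x hx
  obtain ⟨a, b, h⟩ := not_not.mp hx
  filter_upwards [h.eventually_nhds] with y hy
  exact not_not.mpr ⟨a, b, hy⟩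

theorem breakSet_one : breakSet (1 : ℝ ≃ₜ ℝ) = ∅ := by
  ext x
  simp only [breakSet, Set.mem_ofPred_eq, Set.mem_empty_iff_false, iff_false, not_not]
  exact ⟨1, 0, Filter.Eventually.of_forall fun y => by simp⟩

theorem breakSet_mul_subset (f g : ℝ ≃ₜ ℝ) :
    breakSet (f * g : ℝ ≃ₜ ℝ) ⊆ breakSet g ∪ g ⁻¹' breakSet f := by
  intro x hx
  by_contra hcon
  simp only [Set.mem_union, Set.mem_preimage, not_or, breakSet, Set.mem_ofPred_eq, not_not] at hcon
  obtain ⟨⟨a, b, hg⟩, c, d, hf⟩ := hcon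
  refine hx ⟨c * a, c * b + d, ?_⟩
  filter_upwards [hg, g.continuous.continuousAt.eventually hf] with y h1 h2
  change f (g y) = _
  rw [h2, h1]
  ring

theorem breakSet_inv_subset (f : ℝ ≃ₜ ℝ) :
    breakSet (f⁻¹ : ℝ ≃ₜ ℝ) ⊆ (f⁻¹ : ℝ ≃ₜ ℝ) ⁻¹' breakSet f := by
  intro x hx hcon
  obtain ⟨a, b, hf⟩ := hcon
  have hc : ∀ y, f ((f⁻¹ : ℝ ≃ₜ ℝ) y) = y := fun y => f.apply_symm_apply y
  have ht := (f⁻¹ : ℝ ≃ₜ ℝ).continuous.continuousAt.eventually hf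
  simp only [hc] at ht
  have ha : a ≠ 0 := by
    rintro rfl
    have h0 : ∀ᶠ y in nhdsWithin x {x}ᶜ, y = b := by
      filter_upwards [ht.filter_mono nhdsWithin_le_nhds] with y hy
      simpa using hy
    have hxb : x = b := by simpa using ht.self_of_nhds
    obtain ⟨y, hy, hy'⟩ := (h0.and self_mem_nhdsWithin).exists
    exact hy' (hy.trans hxb.symm)
  refine hx ⟨a⁻¹, -(a⁻¹ * b), ?_⟩
  filter_upwards [ht] with y hy
  have : a⁻¹ * y = a⁻¹ * (a * (f⁻¹ : ℝ ≃ₜ ℝ) y + b) := by rw [← hy]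
  rw [this]
  field_simp
  ring

theorem discrete_iff (f : ℝ → ℝ) :
    IsDiscrete (breakSet f) ↔ (breakSet f)ᶜ ∈ Filter.codiscrete ℝ := by
  rw [mem_codiscrete', compl_compl, isOpen_compl_iff]
  exact ⟨fun h => ⟨isClosed_breakSet f, h⟩, fun h => h.2⟩

theorem preimage_discrete (f : ℝ → ℝ) (g : ℝ ≃ₜ ℝ) (h : IsDiscrete (breakSet f)) :
    (g ⁻¹' breakSet f)ᶜ ∈ Filter.codiscrete ℝ := by
  rw [mem_codiscrete', compl_compl, isOpen_compl_iff]
  exact ⟨(isClosed_breakSet f).preimage g.continuous,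
    h.preimage g.continuous.continuousOn g.injective⟩

/-- `PLF(ℝ)`: homeomorphisms of the real line that are locally affine at all but finitely many
points, as a subgroup of the group `H(ℝ)` of all homeomorphisms. -/
def PLF : Subgroup (ℝ ≃ₜ ℝ) where
  carrier := {f | (breakSet f).Finite}
  one_mem' := by
    change (breakSet (1 : ℝ ≃ₜ ℝ)).Finite
    rw [breakSet_one]
    exact Set.finite_empty
  mul_mem' := fun {f g} hf hg =>
    (hg.union (hf.preimage g.injective.injOn)).subset (breakSet_mul_subset f g)
  inv_mem' := fun {f} hf =>
    (hf.preimage (f⁻¹ : ℝ ≃ₜ ℝ).injective.injOn).subset (breakSet_inv_subset f)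

/-- `PL(ℝ)`: homeomorphisms of the real line that are locally affine at all but a discrete set
of points, as a subgroup of `H(ℝ)`. The exceptional set is automatically closed. -/
def PL : Subgroup (ℝ ≃ₜ ℝ) where
  carrier := {f | IsDiscrete (breakSet f)}
  one_mem' := by
    change IsDiscrete (breakSet (1 : ℝ ≃ₜ ℝ))
    rw [discrete_iff, breakSet_one]
    simp
  mul_mem' := fun {f g} hf hg => by
    change IsDiscrete (breakSet (f * g : ℝ ≃ₜ ℝ))
    rw [discrete_iff]
    filter_upwards [(discrete_iff g).mp hg, preimage_discrete f g hf] with x h1 h2 h3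
    exact (breakSet_mul_subset f g h3).elim h1 h2
  inv_mem' := fun {f} hf => by
    change IsDiscrete (breakSet (f⁻¹ : ℝ ≃ₜ ℝ))
    rw [discrete_iff]
    filter_upwards [preimage_discrete f f⁻¹ hf] with x h1 h2
    exact h1 (breakSet_inv_subset f h2)

/-- A homeomorphism of the real line preserves orientation if it is strictly increasing. -/
def OrientationPreserving (f : ℝ ≃ₜ ℝ) : Prop := StrictMono f

/-- A homeomorphism of the real line reverses orientation if it is strictly decreasing. -/
def OrientationReversing (f : ℝ ≃ₜ ℝ) : Prop := StrictAnti f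

end Reversibility

namespace Reversibility

open Filter Topology Set

/-! ### Reversers in an arbitrary group. -/

section Group

variable {G : Type*} [Group G]

/-! If a decreasing `h` reverses an increasing `f`, so does `h⁻¹`, and the pointwise minimum of the
two (`minInv`) is an involution that still reverses `f`. Minima stay within `PL` and `PLF`.
Conversely, an increasing involution is trivial, so it can reverse an increasing `f` only if `f =
1`, which `x ↦ -x` reverses.

In `PLF` an increasing reverser forces an increasing `f` to be `1`
(`eq_one_of_reverses_of_mem_PLF`): affine germs show that `f` is the identity near `+∞`, and then to
the left of any endpoint of its ray of fixed points. A decreasing `f` is handled through `f ^ 2`. -/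

theorem reverses_iff {h g : G} : Reverses h g ↔ g * h * g = h := by
  unfold Reverses
  rw [mul_inv_eq_iff_eq_mul, eq_inv_mul_iff_mul_eq, mul_assoc]

theorem Reverses.inv {h g : G} (H : Reverses h g) : Reverses h⁻¹ g := by
  rw [reverses_iff] at *
  conv_lhs => rw [← H]
  group

theorem Reverses.mul_self {h g : G} (H : Reverses h g) : Reverses (h * g) g := by
  unfold Reverses at *
  rw [← H]
  group

theorem Reverses.pow {h g : G} (H : Reverses h g) (n : ℕ) : Reverses h (g ^ n) := by
  unfold Reverses at *
  rw [← conj_pow, H, inv_pow]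

theorem IsStronglyReversible.isReversible {g : G} (H : IsStronglyReversible g) :
    IsReversible g :=
  H.imp fun _ h => h.2

theorem isStronglyReversible_of_sq_eq_one {g : G} (H : g ^ 2 = 1) : IsStronglyReversible g := by
  refine ⟨1, one_pow 2, ?_⟩
  rw [reverses_iff, mul_one, ← sq, H]

end Group

theorem reverses_coe {S : Subgroup (ℝ ≃ₜ ℝ)} {h f : S} :
    Reverses (h : ℝ ≃ₜ ℝ) (f : ℝ ≃ₜ ℝ) ↔ Reverses h f := by
  rw [reverses_iff, reverses_iff, ← Subtype.coe_inj]
  rfl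

theorem Reverses.apply {h f : ℝ ≃ₜ ℝ} (H : Reverses h f) (x : ℝ) : f (h (f x)) = h x :=
  DFunLike.congr_fun (reverses_iff.1 H) x

/-! ### Increasing and decreasing homeomorphisms. -/

section Orientation

theorem orientationPreserving_or_orientationReversing (f : ℝ ≃ₜ ℝ) :
    OrientationPreserving f ∨ OrientationReversing f :=
  f.continuous.strictMono_of_inj f.injective

theorem OrientationReversing.inv {h : ℝ ≃ₜ ℝ} (H : OrientationReversing h) :
    OrientationReversing h⁻¹ := by
  intro x y hxy
  refine H.lt_iff_gt.1 ?_
  change h (h.symm x) < h (h.symm y)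
  simpa using hxy

theorem OrientationPreserving.eq_one_of_sq_eq_one {f : ℝ ≃ₜ ℝ} (hf : OrientationPreserving f)
    (h : f ^ 2 = 1) : f = 1 := by
  ext x
  have hx : f (f x) = x := by
    rw [sq] at h
    exact DFunLike.congr_fun h x
  change f x = x
  rcases lt_trichotomy (f x) x with h1 | h1 | h1
  · have := hf h1
    linarith
  · exact h1
  · have := hf h1
    linarith

end Orientation

/-! ### The involution built from a decreasing homeomorphism. -/

section MinInv

/-- The pointwise minimum of a decreasing homeomorphism and its inverse; an involution. -/
noncomputable def minInv (h : ℝ ≃ₜ ℝ) (H : OrientationReversing h) : ℝ ≃ₜ ℝ :=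
  have key : Function.Involutive fun x => min (h x) (h⁻¹ x) := fun x => by
    have e1 : ∀ y, h (h⁻¹ y) = y := h.apply_symm_apply
    have e2 : ∀ y, h⁻¹ (h y) = y := h.symm_apply_apply
    -- If `h x ≤ h⁻¹ x`, applying the decreasing `h` gives `x ≤ h (h x)`, so at `h x` the minimum is
    -- `h⁻¹ (h x) = x`. The other case is symmetric.
    rcases le_total (h x) (h⁻¹ x) with hx | hx
    · have := H.antitone hx
      rw [e1] at this
      simp only [min_eq_left hx, e2, min_eq_right this]
    · have := H.inv.antitone hx
      rw [e2] at this
      simp only [min_eq_right hx, e1, min_eq_left this]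
  { key.toPerm with
    continuous_toFun := h.continuous.min h⁻¹.continuous
    continuous_invFun := h.continuous.min h⁻¹.continuous }

theorem minInv_apply (h : ℝ ≃ₜ ℝ) (H : OrientationReversing h) (x : ℝ) :
    minInv h H x = min (h x) (h⁻¹ x) := rfl

theorem minInv_sq (h : ℝ ≃ₜ ℝ) (H : OrientationReversing h) : minInv h H ^ 2 = 1 := by
  rw [sq, ← mul_inv_cancel (minInv h H)]
  rfl

theorem Reverses.minInv {h f : ℝ ≃ₜ ℝ} (hr : Reverses h f) (H : OrientationReversing h)
    (hf : OrientationPreserving f) : Reverses (minInv h H) f := by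
  rw [reverses_iff]
  ext x
  change f (Reversibility.minInv h H (f x)) = _
  rw [minInv_apply, hf.monotone.map_min, hr.apply, hr.inv.apply, minInv_apply]

end MinInv

/-! ### Minima of piecewise affine functions. -/

section Affine

theorem affine_of_locallyAffineAt {f : ℝ → ℝ} {U : Set ℝ} (hU : IsOpen U)
    (hc : IsPreconnected U) (hf : ∀ x ∈ U, LocallyAffineAt f x) :
    ∃ a b : ℝ, ∀ x ∈ U, f x = a * x + b := by
  have hd : ∀ x ∈ U, DifferentiableAt ℝ f x ∧ HasDerivAt (deriv f) 0 x := by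
    intro x hx
    obtain ⟨a, b, hab⟩ := hf x hx
    have hder : ∀ y, HasDerivAt (fun y : ℝ => a * y + b) a y := fun y => by
      simpa using ((hasDerivAt_id y).const_mul a).add_const b
    refine ⟨((hder x).congr_of_eventuallyEq hab).differentiableAt, ?_⟩
    refine (hasDerivAt_const x a).congr_of_eventuallyEq ?_
    filter_upwards [hab.eventually_nhds] with y hy
    exact ((hder y).congr_of_eventuallyEq hy).deriv
  obtain ⟨a, ha⟩ := hU.exists_is_const_of_deriv_eq_zero hc
    (fun x hx => (hd x hx).2.differentiableAt.differentiableWithinAt)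
    (fun x hx => (hd x hx).2.deriv)
  have hder : ∀ x ∈ U, HasDerivAt (fun y => f y - a * y) 0 x := by
    intro x hx
    have := (hd x hx).1.hasDerivAt.sub ((hasDerivAt_id x).const_mul a)
    rw [ha x hx, mul_one, sub_self] at this
    exact this
  obtain ⟨b, hb⟩ := hU.exists_is_const_of_deriv_eq_zero hc
    (fun x hx => (hder x hx).differentiableAt.differentiableWithinAt)
    (fun x hx => (hder x hx).deriv)
  exact ⟨a, b, fun x hx => by linarith [hb x hx]⟩

theorem LocallyAffineAt.congr {f g : ℝ → ℝ} {x : ℝ} (hf : LocallyAffineAt f x)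
    (h : g =ᶠ[𝓝 x] f) : LocallyAffineAt g x := by
  obtain ⟨a, b, hab⟩ := hf
  exact ⟨a, b, h.trans hab⟩

theorem LocallyAffineAt.min_of_ne {f g : ℝ → ℝ} {x : ℝ} (hf : LocallyAffineAt f x)
    (hg : LocallyAffineAt g x) (cf : ContinuousAt f x) (cg : ContinuousAt g x)
    (hne : f x ≠ g x) : LocallyAffineAt (fun y => min (f y) (g y)) x := by
  rcases hne.lt_or_gt with h | h
  · refine hf.congr ?_
    filter_upwards [cf.eventually_lt cg h] with y hy
    exact min_eq_left hy.le
  · refine hg.congr ?_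
    filter_upwards [cg.eventually_lt cf h] with y hy
    exact min_eq_right hy.le

/-- The minimum can break only where the graphs cross, and two distinct affine functions cross at
most once. -/
theorem subsingleton_inter_breakSet_min {f g : ℝ → ℝ} (cf : Continuous f) (cg : Continuous g)
    {U : Set ℝ} (hU : IsOpen U) (hc : IsPreconnected U)
    (hf : ∀ x ∈ U, LocallyAffineAt f x) (hg : ∀ x ∈ U, LocallyAffineAt g x) :
    (U ∩ breakSet fun y => min (f y) (g y)).Subsingleton := by
  obtain ⟨a, b, hab⟩ := affine_of_locallyAffineAt hU hc hf
  obtain ⟨c, d, hcd⟩ := affine_of_locallyAffineAt hU hc hg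
  have key : ∀ x ∈ U ∩ breakSet (fun y => min (f y) (g y)), a ≠ c ∧ a * x + b = c * x + d := by
    rintro x ⟨hx, hb⟩
    have heq : f x = g x := by
      by_contra hne
      exact hb ((hf x hx).min_of_ne (hg x hx) cf.continuousAt cg.continuousAt hne)
    have heq' : a * x + b = c * x + d := by rw [← hab x hx, ← hcd x hx, heq]
    refine ⟨?_, heq'⟩
    rintro rfl
    refine hb ((hf x hx).congr ?_)
    filter_upwards [hU.mem_nhds hx] with y hy
    rw [hab y hy, hcd y hy, add_left_cancel heq', min_self]
  intro x hx y hy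
  obtain ⟨hac, h1⟩ := key x hx
  obtain ⟨-, h2⟩ := key y hy
  have : (a - c) * (x - y) = 0 := by linear_combination h1 - h2
  rcases mul_eq_zero.1 this with h | h
  · exact absurd (sub_eq_zero.1 h) hac
  · exact sub_eq_zero.1 h

theorem isDiscrete_breakSet_iff {f : ℝ → ℝ} :
    IsDiscrete (breakSet f) ↔ ∀ x, ∀ᶠ y in 𝓝[≠] x, LocallyAffineAt f y := by
  rw [discrete_iff, mem_codiscrete]
  refine forall_congr' fun x => ?_
  rw [disjoint_principal_right, compl_compl]
  simp only [breakSet, compl_ofPred, not_not]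
  rfl

theorem eventually_notMem_of_subsingleton {s : Set ℝ} (hs : s.Subsingleton) (x : ℝ) :
    ∀ᶠ y in 𝓝[≠] x, y ∉ s := by
  have : (s \ {x})ᶜ ∈ 𝓝 x :=
    (hs.anti sdiff_subset).finite.isClosed.isOpen_compl.mem_nhds fun h => h.2 rfl
  filter_upwards [nhdsWithin_le_nhds this, self_mem_nhdsWithin] with y hy hyx hys
  exact hy ⟨hys, hyx⟩

theorem isDiscrete_breakSet_min {f g : ℝ → ℝ} (cf : Continuous f) (cg : Continuous g)
    (hf : IsDiscrete (breakSet f)) (hg : IsDiscrete (breakSet g)) :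
    IsDiscrete (breakSet fun y => min (f y) (g y)) := by
  rw [isDiscrete_breakSet_iff] at *
  intro x
  have hfg := (hf x).and (hg x)
  -- A punctured neighbourhood is disconnected, so each side is treated as its own interval.
  rw [← nhdsLT_sup_nhdsGT, eventually_sup] at hfg ⊢
  constructor
  · obtain ⟨u, hu, h⟩ := mem_nhdsLT_iff_exists_Ioo_subset.1 hfg.1
    have hs := subsingleton_inter_breakSet_min cf cg isOpen_Ioo isPreconnected_Ioo
      (fun y hy => (h hy).1) (fun y hy => (h hy).2)
    filter_upwards [Ioo_mem_nhdsLT hu,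
      nhdsLT_le_nhdsNE x (eventually_notMem_of_subsingleton hs x)] with y hy hys
    exact not_not.1 fun hb => hys ⟨hy, hb⟩
  · obtain ⟨u, hu, h⟩ := mem_nhdsGT_iff_exists_Ioo_subset.1 hfg.2
    have hs := subsingleton_inter_breakSet_min cf cg isOpen_Ioo isPreconnected_Ioo
      (fun y hy => (h hy).1) (fun y hy => (h hy).2)
    filter_upwards [Ioo_mem_nhdsGT hu,
      nhdsGT_le_nhdsNE x (eventually_notMem_of_subsingleton hs x)] with y hy hys
    exact not_not.1 fun hb => hys ⟨hy, hb⟩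

theorem finite_breakSet_min {f g : ℝ → ℝ} (cf : Continuous f) (cg : Continuous g)
    (hf : (breakSet f).Finite) (hg : (breakSet g).Finite) :
    (breakSet fun y => min (f y) (g y)).Finite := by
  have hd := isDiscrete_breakSet_min cf cg hf.isDiscrete hg.isDiscrete
  obtain ⟨M, hM⟩ := (hf.union hg).bddAbove
  obtain ⟨m, hm⟩ := (hf.union hg).bddBelow
  have hR := subsingleton_inter_breakSet_min cf cg isOpen_Ioi isPreconnected_Ioi (U := Ioi M)
    (fun y hy => not_not.1 fun h => (hM (Or.inl h)).not_gt hy)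
    (fun y hy => not_not.1 fun h => (hM (Or.inr h)).not_gt hy)
  have hL := subsingleton_inter_breakSet_min cf cg isOpen_Iio isPreconnected_Iio (U := Iio m)
    (fun y hy => not_not.1 fun h => (hm (Or.inl h)).not_gt hy)
    (fun y hy => not_not.1 fun h => (hm (Or.inr h)).not_gt hy)
  -- A closed discrete set meets a compact interval in finitely many points.
  have hC : (Icc m M ∩ breakSet fun y => min (f y) (g y)).Finite :=
    (isCompact_Icc.inter_right (isClosed_breakSet _)).finite (hd.mono inter_subset_right)
  refine ((hC.union hR.finite).union hL.finite).subset fun x hx => ?_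
  rcases lt_or_ge x m with h | h
  · exact Or.inr ⟨h, hx⟩
  rcases lt_or_ge M x with h' | h'
  · exact Or.inl (Or.inr ⟨h', hx⟩)
  · exact Or.inl (Or.inl ⟨⟨h, h'⟩, hx⟩)

theorem minInv_mem_PL {h : ℝ ≃ₜ ℝ} (H : OrientationReversing h) (hh : h ∈ PL) :
    minInv h H ∈ PL :=
  isDiscrete_breakSet_min h.continuous h⁻¹.continuous hh (PL.inv_mem hh)

theorem minInv_mem_PLF {h : ℝ ≃ₜ ℝ} (H : OrientationReversing h) (hh : h ∈ PLF) :
    minInv h H ∈ PLF :=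
  finite_breakSet_min h.continuous h⁻¹.continuous hh (PLF.inv_mem hh)

theorem neg_mem_PL : Homeomorph.neg ℝ ∈ PL := by
  change IsDiscrete _
  rw [isDiscrete_breakSet_iff]
  exact fun x => Eventually.of_forall fun y => ⟨-1, 0, Eventually.of_forall fun z => by simp⟩

theorem orientationReversing_neg : OrientationReversing (Homeomorph.neg ℝ) :=
  fun _ _ h => neg_lt_neg h

theorem reverses_one (h : ℝ ≃ₜ ℝ) : Reverses h 1 := by
  rw [reverses_iff, one_mul, mul_one]

end Affine

/-! ### Rigidity under an increasing reverser. -/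

section IncreasingReverser

/-- For affine germs, `f h f = h` compares slopes as `a² c = c`, so `a = 1`; the constant terms then
give `(c + 1) b = 0`. The filter `l` covers both `+∞` and the left side of a fixed point. -/
theorem eventually_eq_self_of_reverses {f h : ℝ ≃ₜ ℝ} (hf : OrientationPreserving f)
    (hh : OrientationPreserving h) (hr : Reverses h f) {l : Filter ℝ} [l.NeBot]
    (hl : l ≤ cofinite) (tf : Tendsto f l l) (th : Tendsto h l l)
    (af : ∃ a b : ℝ, ∀ᶠ x in l, f x = a * x + b) (ah : ∃ c d : ℝ, ∀ᶠ x in l, h x = c * x + d) :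
    ∀ᶠ x in l, f x = x := by
  obtain ⟨a, b, hab⟩ := af
  obtain ⟨c, d, hcd⟩ := ah
  have key : ∀ᶠ x in l, f x = a * x + b ∧ h x = c * x + d ∧
      a * (c * (a * x + b) + d) + b = c * x + d := by
    filter_upwards [hab, hcd, tf.eventually hcd, (th.comp tf).eventually hab] with x h1 h2 h3 h4
    refine ⟨h1, h2, ?_⟩
    have := hr.apply x
    simp only [Function.comp_apply] at h4
    rw [h4, h3, h1, h2] at this
    exact this
  obtain ⟨x, fx, hx, ex⟩ := key.exists
  obtain ⟨y, ⟨fy, hy, ey⟩, hne⟩ := (key.and (hl (finite_singleton x).compl_mem_cofinite)).exists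
  have hne : y ≠ x := hne
  have slope : ∀ {k : ℝ ≃ₜ ℝ} {s t : ℝ}, OrientationPreserving k → k x = s * x + t →
      k y = s * y + t → 0 < s := by
    intro k s t hk kx ky
    rcases hne.lt_or_gt with h | h
    · have := hk h
      rw [kx, ky] at this
      nlinarith
    · have := hk h
      rw [kx, ky] at this
      nlinarith
  have ha : 0 < a := slope hf fx fy
  have hc : 0 < c := slope hh hx hy
  have h1 : c * (a + 1) * (y - x) * (a - 1) = 0 := by linear_combination ey - ex
  have ha1 : a = 1 := by
    have : c * (a + 1) * (y - x) ≠ 0 :=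
      mul_ne_zero (by positivity) (sub_ne_zero.2 hne)
    linarith [(mul_eq_zero.1 h1).resolve_left this]
  subst ha1
  have hb : (c + 1) * b = 0 := by linear_combination ex
  have hb : b = 0 := (mul_eq_zero.1 hb).resolve_left (by positivity)
  filter_upwards [hab] with z hz
  rw [hz, hb]
  ring

theorem exists_affine_atTop {f : ℝ ≃ₜ ℝ} (hf : f ∈ PLF) :
    ∃ a b : ℝ, ∀ᶠ x in atTop, f x = a * x + b := by
  obtain ⟨M, hM⟩ := Set.Finite.bddAbove (s := breakSet f) hf
  obtain ⟨a, b, h⟩ := affine_of_locallyAffineAt isOpen_Ioi isPreconnected_Ioi (U := Ioi M) (f := f)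
    (fun y hy => not_not.1 fun h => (hM h).not_gt hy)
  exact ⟨a, b, (eventually_gt_atTop M).mono h⟩

theorem exists_affine_nhdsLT {f : ℝ ≃ₜ ℝ} (hf : f ∈ PL) (p : ℝ) :
    ∃ a b : ℝ, ∀ᶠ x in 𝓝[<] p, f x = a * x + b := by
  have := nhdsLT_le_nhdsNE p (isDiscrete_breakSet_iff.1 hf p)
  obtain ⟨q, hq, h⟩ := mem_nhdsLT_iff_exists_Ioo_subset.1 this
  obtain ⟨a, b, hab⟩ := affine_of_locallyAffineAt isOpen_Ioo isPreconnected_Ioo h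
  exact ⟨a, b, mem_of_superset (Ioo_mem_nhdsLT hq) hab⟩

theorem PLF_le_PL : PLF ≤ PL := fun f hf =>
  Set.Finite.isDiscrete (s := breakSet f) hf

theorem OrientationPreserving.tendsto_atTop {f : ℝ ≃ₜ ℝ} (hf : OrientationPreserving f) :
    Tendsto f atTop atTop :=
  hf.monotone.tendsto_atTop_atTop fun b => ⟨f.symm b, by simp⟩

theorem OrientationPreserving.tendsto_nhdsLT {f : ℝ ≃ₜ ℝ} (hf : OrientationPreserving f) {p : ℝ}
    (hp : f p = p) : Tendsto f (𝓝[<] p) (𝓝[<] p) := by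
  refine tendsto_nhdsWithin_iff.2 ⟨?_, ?_⟩
  · simpa [hp] using (f.continuous.tendsto p).mono_left nhdsWithin_le_nhds
  · filter_upwards [self_mem_nhdsWithin] with x hx
    simpa [hp] using hf hx

theorem eq_one_of_reverses_of_mem_PLF {f h : ℝ ≃ₜ ℝ} (hfP : f ∈ PLF) (hhP : h ∈ PLF)
    (hf : OrientationPreserving f) (hh : OrientationPreserving h) (hr : Reverses h f) :
    f = 1 := by
  have htop : ∀ᶠ x in atTop, f x = x :=
    eventually_eq_self_of_reverses hf hh hr atTop_le_cofinite hf.tendsto_atTop hh.tendsto_atTop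
      (exists_affine_atTop hfP) (exists_affine_atTop hhP)
  set S : Set ℝ := {x | ∀ y, x ≤ y → f y = y} with hS
  have hne : S.Nonempty := eventually_atTop.1 htop
  -- Reversers preserve the fixed points of `f`; hence `h` and its inverse preserve `S`, and `h`
  -- fixes its least element.
  have fixed_apply : ∀ {k : ℝ ≃ₜ ℝ} {y : ℝ}, Reverses k f → f y = y → f (k y) = k y := by
    intro k y hk hy
    simpa [hy] using hk.apply y
  have hpS : ¬ BddBelow S := by
    intro hb
    set p := sInf S
    have hgt : ∀ y, p < y → f y = y := by
      intro y hy
      obtain ⟨x, hx, hxy⟩ := exists_lt_of_csInf_lt hne hy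
      exact hx y hxy.le
    have hpf : f p = p := by
      have hcl : IsClosed {y | f y = y} := isClosed_eq f.continuous continuous_id
      have : closure (Ioi p) ⊆ {y | f y = y} := hcl.closure_subset_iff.2 hgt
      rw [closure_Ioi] at this
      exact this self_mem_Ici
    have hmem : p ∈ S := fun y hy => hy.eq_or_lt.elim (fun e => e ▸ hpf) (hgt y)
    have hhp : h p ∈ S := by
      intro y hy
      have h1 : p ≤ h.symm y := hh.le_iff_le.1 (by simpa using hy)
      simpa using fixed_apply hr (hmem _ h1)
    have hhp' : h.symm p ∈ S := by
      intro y hy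
      have h1 : p ≤ h y := by simpa using hh.monotone hy
      have := fixed_apply hr.inv (hmem _ h1)
      change f (h.symm (h y)) = h.symm (h y) at this
      simpa using this
    have h_fix : h p = p := by
      refine le_antisymm ?_ (csInf_le hb hhp)
      simpa using hh.monotone (csInf_le hb hhp')
    have hleft : ∀ᶠ x in 𝓝[<] p, f x = x :=
      eventually_eq_self_of_reverses hf hh hr
        ((nhdsLT_le_nhdsNE p).trans (nhdsNE_le_cofinite p))
        (hf.tendsto_nhdsLT hpf) (hh.tendsto_nhdsLT h_fix)
        (exists_affine_nhdsLT (PLF_le_PL hfP) p) (exists_affine_nhdsLT (PLF_le_PL hhP) p)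
    obtain ⟨q, hq, hqp⟩ := mem_nhdsLT_iff_exists_Ioo_subset.1 hleft
    obtain ⟨r, hqr, hrp⟩ := exists_between (mem_Iio.1 hq)
    refine (csInf_le hb (a := r) fun y hy => ?_).not_gt hrp
    rcases lt_or_ge y p with h1 | h1
    · exact hqp ⟨hqr.trans_le hy, h1⟩
    · exact hmem y h1
  ext x
  obtain ⟨y, hy, hyx⟩ := not_bddBelow_iff.1 hpS x
  exact hy x hyx.le

end IncreasingReverser

theorem exists_orientationReversing_reverses {S : Subgroup (ℝ ≃ₜ ℝ)}
    (hS : Homeomorph.neg ℝ ∈ S) {f : S} (hf : OrientationPreserving (f : ℝ ≃ₜ ℝ))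
    (h : IsStronglyReversible f) :
    ∃ h : S, OrientationReversing (h : ℝ ≃ₜ ℝ) ∧ Reverses h f := by
  obtain ⟨σ, hσ, hr⟩ := h
  rcases orientationPreserving_or_orientationReversing (σ : ℝ ≃ₜ ℝ) with h | h
  · have h1 : σ = 1 := Subtype.ext (h.eq_one_of_sq_eq_one (congrArg Subtype.val hσ))
    have h2 : f ^ 2 = 1 := by simpa [h1, ← sq] using reverses_iff.1 hr
    have h3 : f = 1 := Subtype.ext (hf.eq_one_of_sq_eq_one (congrArg Subtype.val h2))
    refine ⟨⟨_, hS⟩, orientationReversing_neg, reverses_coe.1 ?_⟩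
    rw [h3]
    exact reverses_one _
  · exact ⟨σ, h, hr⟩

theorem isStronglyReversible_of_orientationReversing {S : Subgroup (ℝ ≃ₜ ℝ)}
    (hS : ∀ (h : ℝ ≃ₜ ℝ) (H : OrientationReversing h), h ∈ S → minInv h H ∈ S)
    {f h : S} (hf : OrientationPreserving (f : ℝ ≃ₜ ℝ))
    (H : OrientationReversing (h : ℝ ≃ₜ ℝ)) (hr : Reverses h f) : IsStronglyReversible f :=
  ⟨⟨minInv h H, hS h H h.2⟩, Subtype.ext (minInv_sq _ H),
    reverses_coe.1 ((reverses_coe.2 hr).minInv H hf)⟩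

theorem isStronglyReversible_of_isReversible_PLF {f : PLF} (h : IsReversible f) :
    IsStronglyReversible f := by
  obtain ⟨h, hr⟩ := h
  have hr' := reverses_coe.2 hr
  rcases orientationPreserving_or_orientationReversing (f : ℝ ≃ₜ ℝ) with hf | hf
  · rcases orientationPreserving_or_orientationReversing (h : ℝ ≃ₜ ℝ) with hh | hh
    · have : f = 1 := Subtype.ext (eq_one_of_reverses_of_mem_PLF f.2 h.2 hf hh hr')
      exact isStronglyReversible_of_sq_eq_one (by rw [this, one_pow])
    · exact isStronglyReversible_of_orientationReversing (fun _ => minInv_mem_PLF) hf hh hr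
  · obtain ⟨k, hk, hkr⟩ : ∃ k : PLF, OrientationPreserving (k : ℝ ≃ₜ ℝ) ∧ Reverses k f := by
      rcases orientationPreserving_or_orientationReversing (h : ℝ ≃ₜ ℝ) with hh | hh
      · exact ⟨h, hh, hr⟩
      -- Composing two decreasing maps yields an increasing reverser.
      · exact ⟨h * f, hh.comp hf, hr.mul_self⟩
    refine isStronglyReversible_of_sq_eq_one (Subtype.ext ?_)
    have hf2 : OrientationPreserving ((f ^ 2 : PLF) : ℝ ≃ₜ ℝ) := by
      rw [sq]
      exact hf.comp hf
    exact eq_one_of_reverses_of_mem_PLF (f ^ 2).2 k.2 hf2 hk (reverses_coe.2 (hkr.pow 2))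

end Reversibility

theorem theoremT :
    (∀ f : ℝ ≃ₜ ℝ, Reversibility.OrientationPreserving f → Reversibility.IsReversible f →
      (Reversibility.IsStronglyReversible f ↔
        ∃ h : ℝ ≃ₜ ℝ, Reversibility.OrientationReversing h ∧ Reversibility.Reverses h f)) ∧
    (∀ f : Reversibility.PLF,
      Reversibility.IsReversible f ↔ Reversibility.IsStronglyReversible f) ∧
    (∀ f : Reversibility.PL, Reversibility.OrientationPreserving (f : ℝ ≃ₜ ℝ) →
      Reversibility.IsReversible f →
      (Reversibility.IsStronglyReversible f ↔
        ∃ h : Reversibility.PL, Reversibility.OrientationReversing (h : ℝ ≃ₜ ℝ) ∧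
          Reversibility.Reverses h f)) := by
  open Reversibility in
  refine ⟨fun f hf _ => ⟨fun ⟨σ, hσ, hr⟩ => ?_, fun ⟨h, H, hr⟩ => ?_⟩, fun f => ?_,
    fun f hf _ => ⟨exists_orientationReversing_reverses neg_mem_PL hf, fun ⟨h, H, hr⟩ => ?_⟩⟩
  -- The full homeomorphism group is treated as its own top subgroup.
  · obtain ⟨h, H, hr⟩ := exists_orientationReversing_reverses (S := ⊤) (Subgroup.mem_top _)
      (f := ⟨f, Subgroup.mem_top f⟩) hf
      ⟨⟨σ, Subgroup.mem_top σ⟩, Subtype.ext hσ, reverses_coe.1 hr⟩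
    exact ⟨h, H, reverses_coe.2 hr⟩
  · exact ⟨minInv h H, minInv_sq h H, hr.minInv H hf⟩
  · exact ⟨isStronglyReversible_of_isReversible_PLF, IsStronglyReversible.isReversible⟩
  · exact isStronglyReversible_of_orientationReversing (fun _ => minInv_mem_PL) hf H hr
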